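/- A monounary algebra is a set $A$ with one operation $f\colon A\to A$. A subalgebra $\mathfrak A\subseteq\mathfrak B$ is large if $\mathfrak B$ is generated by $A\cup\{b\}$ for some $b\in B$. For a class $\mathrm K$ of monounary algebras, consider the network whose vertices are the members of $\mathrm K$, with a red edge between any two isomorphic members and a blue edge between two members whenever one of them is a large subalgebra of the other. The generator distance $\mathsf d(\mathfrak A,\mathfrak B)\in\omega\cup\{\infty\}$ in $\mathrm K$ is the least number of blue edges of a path connecting $\mathfrak A$ and $\mathfrak B$ in this network, and $\infty$ if there is no path. The algebra $\langle A,f\rangle$ is connected if for all $a,b\in A$ there are $k,m\in\omega$ with $f^k(a)=f^m(b)$. A core of a connected algebra is a subalgebra isomorphic to $\langle\omega,x\mapsto x+1\rangle$ or to a cycle of length $n\ge 1$. A tree-algebra is a connected monounary algebra $\mathfrak T=\langle T,f\rangle$ whose core is isomorphic to the cycle of length one, that is, consists of a single element $c$ with $f(c)=c$. Its associated forest-algebra of main subtrees is $\mathfrak F=\langle T\setminus\{c\},g\rangle$, where $g(x)=x$ if $f(x)=c$, and $g(x)=f(x)$ otherwise. Proposition. Let $\mathfrak T_1,\mathfrak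 T_2$ be tree-algebras (finite or infinite) with associated forest-algebras $\mathfrak F_1,\mathfrak F_2$. Then $$\mathsf d(\mathfrak T_1,\mathfrak T_2)=\mathsf d(\mathfrak F_1,\mathfrak F_2),$$ where $\mathsf d$ is the generator distance in the class of all monounary algebras, the empty algebra included. If $\mathfrak T_1$ and $\mathfrak T_2$ have at least two elements each (so that $\mathfrak F_1,\mathfrak F_2$ are nonempty), then the same equality holds for the generator distance in the class of all nonempty monounary algebras. -/

import Mathlib

universe u v

/-- A monounary algebra `⟨A, f⟩`: a set with one unary operation. The empty algebra is a term of
this type; whether it is admitted is decided by the class over which the network is built. -/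
structure MonounaryAlgebra : Type (u + 1) where
  carrier : Type u
  op : carrier → carrier

namespace MonounaryAlgebra

instance : CoeSort MonounaryAlgebra.{u} (Type u) := ⟨MonounaryAlgebra.carrier⟩

/-- Isomorphism of monounary algebras (possibly living in different universes). -/
def Isomorphic (A : MonounaryAlgebra.{u}) (B : MonounaryAlgebra.{v}) : Prop :=
  ∃ e : A ≃ B, ∀ x : A, e (A.op x) = B.op (e x)

/-- A subalgebra, given by its universe: a subset closed under the operation. -/
structure Subuniverse (A : MonounaryAlgebra.{u}) where
  carrier : Set A
  op_mem : ∀ x ∈ carrier, A.op x ∈ carrier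

namespace Subuniverse

variable {A : MonounaryAlgebra.{u}}

/-- A subalgebra, regarded as a monounary algebra. -/
def toAlgebra (S : A.Subuniverse) : MonounaryAlgebra.{u} where
  carrier := S.carrier
  op x := ⟨A.op x.1, S.op_mem x.1 x.2⟩

/-- `⟨X⟩`, the subalgebra generated by `X`: the intersection of all subalgebras containing `X`. -/
def generated (X : Set A) : A.Subuniverse where
  carrier := {x | ∀ S : A.Subuniverse, X ⊆ S.carrier → x ∈ S.carrier}
  op_mem x hx S hS := S.op_mem x (hx S hS)

/-- `S` is a large subalgebra of `A`: for some `b ∈ A`, the set `S ∪ {b}` generates `A`. -/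
def IsLarge (S : A.Subuniverse) : Prop :=
  ∃ b : A, (generated (S.carrier ∪ {b})).carrier = Set.univ

end Subuniverse

/-! ### The network of large embeddings in a class `K`, and the generator distance -/

/-- Blue edges: one of the two algebras is a large subalgebra of the other. -/
def BlueEdge (A B : MonounaryAlgebra.{u}) : Prop :=
  (∃ S : B.Subuniverse, S.IsLarge ∧ A = S.toAlgebra) ∨
    (∃ S : A.Subuniverse, S.IsLarge ∧ B = S.toAlgebra)

/-- `HasPath K A B l`: the network of large embeddings of the class `K` (vertices: the members of
`K`; red edges: isomorphic members; blue edges: as above) has a path from `A` to `B` with exactly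
`l` blue edges. -/
inductive HasPath (K : MonounaryAlgebra.{u} → Prop) :
    MonounaryAlgebra.{u} → MonounaryAlgebra.{u} → ℕ → Prop
  | nil (A : MonounaryAlgebra.{u}) (hA : K A) : HasPath K A A 0
  | red {A B C : MonounaryAlgebra.{u}} {l : ℕ} (p : HasPath K A B l) (hC : K C)
      (e : Isomorphic B C) : HasPath K A C l
  | blue {A B C : MonounaryAlgebra.{u}} {l : ℕ} (p : HasPath K A B l) (hC : K C)
      (e : BlueEdge B C) : HasPath K A C (l + 1)

/-- The generator distance in the class `K`: the least blue-length of a path connecting `A` and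
`B`, and `∞` (the infimum `⊤` of the empty set) if there is no such path. -/
noncomputable def genDist (K : MonounaryAlgebra.{u} → Prop) (A B : MonounaryAlgebra.{u}) : ℕ∞ :=
  sInf {d : ℕ∞ | ∃ l : ℕ, HasPath K A B l ∧ d = l}

/-- The class of all monounary algebras, the empty one included. -/
def AllAlgebras : MonounaryAlgebra.{u} → Prop := fun _ => True

/-- The class of all nonempty monounary algebras. -/
def NonemptyAlgebras : MonounaryAlgebra.{u} → Prop := fun A => Nonempty A

/-! ### Tree-algebras and their associated forest-algebras -/

/-- The natural numbers with the successor operation. -/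
def natAlgebra : MonounaryAlgebra.{0} := ⟨ℕ, fun x => x + 1⟩

/-- The cycle of length `n`, for `n ≠ 0`. -/
def cycleAlgebra (n : ℕ) : MonounaryAlgebra.{0} := ⟨ZMod n, fun x => x + 1⟩

/-- `A` is connected: any two elements have a common iterated image. -/
def Connected (A : MonounaryAlgebra.{u}) : Prop :=
  ∀ a b : A, ∃ k m : ℕ, A.op^[k] a = A.op^[m] b

/-- `C` is a core: a subalgebra isomorphic to the natural numbers with successor or to a cycle. -/
def Subuniverse.IsCore {A : MonounaryAlgebra.{u}} (C : A.Subuniverse) : Prop :=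
  Isomorphic C.toAlgebra natAlgebra ∨ ∃ n : ℕ, n ≠ 0 ∧ Isomorphic C.toAlgebra (cycleAlgebra n)

/-- A tree-algebra: a connected monounary algebra whose core is isomorphic to the one-element
cycle. -/
def IsTree (A : MonounaryAlgebra.{u}) : Prop :=
  A.Connected ∧ ∃ C : A.Subuniverse, C.IsCore ∧ Isomorphic C.toAlgebra (cycleAlgebra 1)

/-- The one-element core of a tree-algebra (its only core). -/
noncomputable def IsTree.core {T : MonounaryAlgebra.{u}} (h : T.IsTree) : T.Subuniverse :=
  h.2.choose

open Classical in
/-- The associated forest-algebra of main subtrees of a tree-algebra `T`: the core element `c` is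
removed together with the arrows arriving at it, and a loop is attached to every other element that
was mapped to `c`. -/
noncomputable def IsTree.forest {T : MonounaryAlgebra.{u}} (h : T.IsTree) :
    MonounaryAlgebra.{u} where
  carrier := {x : T // x ∉ h.core.carrier}
  op x := if hx : T.op x.1 ∈ h.core.carrier then x else ⟨T.op x.1, hx⟩

end MonounaryAlgebra

/-!
Let `R` delete all fixed points of an algebra and attach a loop to every other element that was
sent to one of them, and let `P` adjoin a new fixed point to which all old fixed points are sent.
Both constructions preserve isomorphisms, and each turns a large subalgebra into a large subalgebra
or, when `R` deletes the additional generator, into an isomorphic algebra. Applied along a path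
they therefore never increase the distance. If `T` has exactly one fixed point, then `P (R T)` is
isomorphic to `T`, and the two inequalities give the equality; for a tree-algebra `R T` is the
forest-algebra.

A path through the empty algebra enters and leaves it at one-generated algebras `M` and `N`. Each
of them is large in their disjoint union, so the detour `M, M ⊔ N, N` has the same length.
-/

namespace MonounaryAlgebra

open Function Set

theorem isFixedPt_apply_iff_of_semiconj {α β : Type*} {f : α → α} {g : β → β} {φ : α → β}
    (hφ : Injective φ) (h : Semiconj φ f g) {x : α} :
    IsFixedPt g (φ x) ↔ IsFixedPt f x := by
  rw [IsFixedPt, ← h.eq, hφ.eq_iff, IsFixedPt]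

/-! ### Large embeddings -/

theorem Isomorphic.symm {A : MonounaryAlgebra.{u}} {B : MonounaryAlgebra.{v}}
    (h : Isomorphic A B) : Isomorphic B A := by
  obtain ⟨e, he⟩ := h
  exact ⟨e.symm, fun x => by rw [Equiv.symm_apply_eq, he, Equiv.apply_symm_apply]⟩

theorem isomorphic_of_bijective {A : MonounaryAlgebra.{u}} {B : MonounaryAlgebra.{v}} {φ : A → B}
    (hφ : Bijective φ) (h : Semiconj φ A.op B.op) : Isomorphic A B :=
  ⟨Equiv.ofBijective φ hφ, h⟩

/-- A large embedding: an embedding of algebras whose image is a large subalgebra, with largeness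
expressed through the iterates of the additional generator. -/
structure IsLargeEmbedding {A : MonounaryAlgebra.{u}} {B : MonounaryAlgebra.{v}} (φ : A → B) :
    Prop where
  injective : Injective φ
  semiconj : Semiconj φ A.op B.op
  exists_generator : ∃ b : B, ∀ y ∉ range φ, ∃ k : ℕ, B.op^[k] b = y

section

variable {A : MonounaryAlgebra.{u}} {B : MonounaryAlgebra.{v}}

theorem Subuniverse.mapsTo_op (S : A.Subuniverse) : MapsTo A.op S.carrier S.carrier :=
  S.op_mem

theorem Subuniverse.mem_generated_iff {X : Set A} {y : A} :
    y ∈ (generated X).carrier ↔ ∃ x ∈ X, ∃ k : ℕ, A.op^[k] x = y := by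
  constructor
  · intro hy
    refine hy ⟨{y | ∃ x ∈ X, ∃ k : ℕ, A.op^[k] x = y}, ?_⟩ fun x hx => ⟨x, hx, 0, rfl⟩
    rintro _ ⟨x, hx, k, rfl⟩
    exact ⟨x, hx, k + 1, iterate_succ_apply' _ _ _⟩
  · rintro ⟨x, hx, k, rfl⟩ S hS
    exact S.mapsTo_op.iterate k (hS hx)

theorem Subuniverse.isLarge_iff {S : A.Subuniverse} :
    S.IsLarge ↔ ∃ b : A, ∀ y ∉ S.carrier, ∃ k : ℕ, A.op^[k] b = y := by
  simp only [IsLarge, eq_univ_iff_forall, mem_generated_iff]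
  refine exists_congr fun b => forall_congr' fun y => ⟨?_, fun h => ?_⟩
  · rintro ⟨x, hx | rfl, k, rfl⟩ hy
    · exact absurd (S.mapsTo_op.iterate k hx) hy
    · exact ⟨k, rfl⟩
  · by_cases hy : y ∈ S.carrier
    · exact ⟨y, Or.inl hy, 0, rfl⟩
    · exact ⟨b, Or.inr rfl, h hy⟩

theorem Subuniverse.IsLarge.isLargeEmbedding_val {S : A.Subuniverse} (h : S.IsLarge) :
    IsLargeEmbedding (A := S.toAlgebra) (B := A) Subtype.val where
  injective := Subtype.val_injective
  semiconj _ := rfl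
  exists_generator := by
    obtain ⟨b, hb⟩ := isLarge_iff.1 h
    exact ⟨b, fun y hy => hb y fun hyS => hy ⟨⟨y, hyS⟩, rfl⟩⟩

theorem IsLargeEmbedding.exists_isLarge {φ : A → B} (h : IsLargeEmbedding φ) :
    ∃ S : B.Subuniverse, S.IsLarge ∧ Isomorphic A S.toAlgebra := by
  have op_mem_range : ∀ y ∈ range φ, B.op y ∈ range φ := by
    rintro _ ⟨x, rfl⟩
    exact ⟨A.op x, h.semiconj x⟩
  exact ⟨⟨range φ, op_mem_range⟩, Subuniverse.isLarge_iff.2 h.exists_generator,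
    Equiv.ofInjective φ h.injective, fun x => Subtype.ext (h.semiconj x)⟩

theorem BlueEdge.symm {A B : MonounaryAlgebra.{u}} (h : BlueEdge A B) : BlueEdge B A :=
  Or.symm h

theorem BlueEdge.exists_isLargeEmbedding {A B : MonounaryAlgebra.{u}}
    (h : BlueEdge A B) :
    (∃ φ : A → B, IsLargeEmbedding φ) ∨ ∃ φ : B → A, IsLargeEmbedding φ := by
  rcases h with ⟨S, hS, rfl⟩ | ⟨S, hS, rfl⟩
  · exact Or.inl ⟨_, hS.isLargeEmbedding_val⟩
  · exact Or.inr ⟨_, hS.isLargeEmbedding_val⟩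

end

/-! ### The generator distance -/

section

variable {K : MonounaryAlgebra.{u} → Prop} {A B C : MonounaryAlgebra.{u}} {l m : ℕ}

theorem HasPath.right_mem (p : HasPath K A B l) : K B := by
  cases p <;> assumption

theorem HasPath.trans (p : HasPath K A B l) (q : HasPath K B C m) : HasPath K A C (l + m) := by
  induction q with
  | nil _ => exact p
  | red _ hC e ih => exact ih.red hC e
  | blue _ hC e ih => exact ih.blue hC e

theorem HasPath.symm (p : HasPath K A B l) : HasPath K B A l := by
  induction p with
  | nil hA => exact .nil A hA
  | red p hC e ih =>
    simpa only [zero_add] using ((HasPath.nil _ hC).red p.right_mem e.symm).trans ih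
  | blue p hC e ih =>
    simpa only [zero_add, add_comm] using ((HasPath.nil _ hC).blue p.right_mem e.symm).trans ih

theorem HasPath.mono {K' : MonounaryAlgebra.{u} → Prop} (hKK' : ∀ A, K A → K' A)
    (p : HasPath K A B l) : HasPath K' A B l := by
  induction p with
  | nil hA => exact .nil _ (hKK' _ hA)
  | red _ hC e ih => exact ih.red (hKK' _ hC) e
  | blue _ hC e ih => exact ih.blue (hKK' _ hC) e

theorem HasPath.genDist_le (p : HasPath K A B l) : genDist K A B ≤ l :=
  sInf_le ⟨l, p, rfl⟩

theorem BlueEdge.genDist_le_one (h : BlueEdge A B) (hA : K A) (hB : K B) : genDist K A B ≤ 1 :=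
  ((HasPath.nil A hA).blue hB h).genDist_le

theorem le_genDist {d : ℕ∞} (h : ∀ l : ℕ, HasPath K A B l → d ≤ l) : d ≤ genDist K A B := by
  refine le_sInf ?_
  rintro _ ⟨l, p, rfl⟩
  exact h l p

theorem exists_hasPath_of_genDist_ne_top (h : genDist K A B ≠ ⊤) :
    ∃ l : ℕ, HasPath K A B l ∧ genDist K A B = l := by
  refine csInf_mem (s := {d : ℕ∞ | ∃ l : ℕ, HasPath K A B l ∧ d = l})
    (nonempty_iff_ne_empty.2 fun hempty => h ?_)
  rw [genDist, hempty, sInf_empty]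

theorem genDist_triangle : genDist K A C ≤ genDist K A B + genDist K B C := by
  by_cases hAB : genDist K A B = ⊤
  · simp only [hAB, top_add, le_top]
  by_cases hBC : genDist K B C = ⊤
  · simp only [hBC, add_top, le_top]
  obtain ⟨l, p, hl⟩ := exists_hasPath_of_genDist_ne_top hAB
  obtain ⟨m, q, hm⟩ := exists_hasPath_of_genDist_ne_top hBC
  rw [hl, hm]
  exact_mod_cast (p.trans q).genDist_le

theorem genDist_comm : genDist K A B = genDist K B A :=
  le_antisymm (le_genDist fun _ p => p.symm.genDist_le) (le_genDist fun _ p => p.symm.genDist_le)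

theorem Isomorphic.genDist_eq_zero (e : Isomorphic A B) (hA : K A) (hB : K B) :
    genDist K A B = 0 :=
  nonpos_iff_eq_zero.1 ((HasPath.nil A hA).red hB e).genDist_le

theorem Isomorphic.genDist_le_left (e : Isomorphic A B) (hA : K A) (hB : K B) :
    genDist K A C ≤ genDist K B C :=
  genDist_triangle.trans (by rw [e.genDist_eq_zero hA hB, zero_add])

theorem Isomorphic.genDist_le_right (e : Isomorphic B C) (hB : K B) (hC : K C) :
    genDist K A C ≤ genDist K A B := by
  simpa only [genDist_comm (A := A)] using e.symm.genDist_le_left hC hB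

theorem genDist_mono {K' : MonounaryAlgebra.{u} → Prop} (hKK' : ∀ A, K A → K' A) :
    genDist K' A B ≤ genDist K A B :=
  le_genDist fun _ p => (p.mono hKK').genDist_le

/-- A class of algebras closed under isomorphism. In such a class a large embedding is as good as
a large subalgebra, since the image of the embedding belongs to the class too. -/
def IsomorphismClosed (K : MonounaryAlgebra.{u} → Prop) : Prop :=
  ∀ ⦃A B : MonounaryAlgebra.{u}⦄, Isomorphic A B → K A → K B

theorem isomorphismClosed_allAlgebras : IsomorphismClosed AllAlgebras.{u} :=
  fun _ _ _ _ => trivial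

theorem isomorphismClosed_nonemptyAlgebras : IsomorphismClosed NonemptyAlgebras.{u} :=
  fun _ _ ⟨e, _⟩ hA => hA.map e

theorem IsLargeEmbedding.genDist_le_one (hK : IsomorphismClosed K) {φ : A → B}
    (h : IsLargeEmbedding φ) (hA : K A) (hB : K B) : genDist K A B ≤ 1 := by
  obtain ⟨S, hS, e⟩ := h.exists_isLarge
  have hedge : BlueEdge S.toAlgebra B := Or.inl ⟨S, hS, rfl⟩
  exact (e.genDist_le_left hA (hK e hA)).trans (hedge.genDist_le_one (hK e hA) hB)

theorem genDist_map_le {K' : MonounaryAlgebra.{v} → Prop}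
    {Φ : MonounaryAlgebra.{u} → MonounaryAlgebra.{v}} (hK : ∀ A, K A → K' (Φ A))
    (hiso : ∀ ⦃A B⦄, K A → K B → Isomorphic A B → Isomorphic (Φ A) (Φ B))
    (hlarge : ∀ ⦃A B : MonounaryAlgebra.{u}⦄ ⦃φ : A → B⦄, K A → K B → IsLargeEmbedding φ →
      genDist K' (Φ A) (Φ B) ≤ 1) :
    genDist K' (Φ A) (Φ B) ≤ genDist K A B := by
  refine le_genDist fun l p => ?_
  induction p with
  | nil hA => exact (HasPath.nil _ (hK A hA)).genDist_le
  | red p hC e ih =>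
    exact ((hiso p.right_mem hC e).genDist_le_right (hK _ p.right_mem) (hK _ hC)).trans ih
  | @blue B C l p hC e ih =>
    have hBC : genDist K' (Φ B) (Φ C) ≤ 1 := by
      rcases e.exists_isLargeEmbedding with ⟨φ, hφ⟩ | ⟨φ, hφ⟩
      · exact hlarge p.right_mem hC hφ
      · exact genDist_comm.trans_le (hlarge hC p.right_mem hφ)
    exact genDist_triangle.trans (add_le_add ih hBC)

end

/-! ### Adjoining a fixed point -/

open Classical in
/-- The algebra obtained from `A` by adjoining a new fixed point `none`, to which all fixed points
of `A` are sent. -/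
noncomputable def adjoinFixedPoint (A : MonounaryAlgebra.{u}) : MonounaryAlgebra.{u} where
  carrier := Option A
  op x := x.bind fun a => if IsFixedPt A.op a then none else some (A.op a)

section

variable {A : MonounaryAlgebra.{u}} {B : MonounaryAlgebra.{v}}

theorem adjoinFixedPoint_op_some_of_isFixedPt {a : A} (h : IsFixedPt A.op a) :
    A.adjoinFixedPoint.op (some a) = none :=
  if_pos h

theorem adjoinFixedPoint_op_some_of_not_isFixedPt {a : A} (h : ¬IsFixedPt A.op a) :
    A.adjoinFixedPoint.op (some a) = some (A.op a) :=
  if_neg h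

theorem semiconj_optionMap {φ : A → B} (hinj : Injective φ) (hop : Semiconj φ A.op B.op) :
    Semiconj (Option.map φ) A.adjoinFixedPoint.op B.adjoinFixedPoint.op := by
  rintro (_ | a)
  · rfl
  have hfix := isFixedPt_apply_iff_of_semiconj hinj hop (x := a)
  by_cases ha : IsFixedPt A.op a
  · rw [adjoinFixedPoint_op_some_of_isFixedPt ha]
    exact (adjoinFixedPoint_op_some_of_isFixedPt (hfix.2 ha)).symm
  · rw [adjoinFixedPoint_op_some_of_not_isFixedPt ha]
    exact (congrArg some (hop a)).trans
      (adjoinFixedPoint_op_some_of_not_isFixedPt (hfix.not.2 ha)).symm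

theorem Isomorphic.adjoinFixedPoint (h : Isomorphic A B) :
    Isomorphic A.adjoinFixedPoint B.adjoinFixedPoint := by
  obtain ⟨e, he⟩ := h
  exact ⟨Equiv.optionCongr e, semiconj_optionMap e.injective he⟩

theorem exists_iterate_adjoinFixedPoint_eq_some (b : A) (k : ℕ) :
    ∃ j : ℕ, A.adjoinFixedPoint.op^[j] (some b) = some (A.op^[k] b) := by
  induction k with
  | zero => exact ⟨0, rfl⟩
  | succ k ih =>
    obtain ⟨j, hj⟩ := ih
    rw [iterate_succ_apply']
    by_cases hfix : IsFixedPt A.op (A.op^[k] b)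
    · exact ⟨j, by rw [hj, hfix.eq]⟩
    · exact ⟨j + 1, (iterate_succ_apply' _ _ _).trans
        ((congrArg _ hj).trans (adjoinFixedPoint_op_some_of_not_isFixedPt hfix))⟩

theorem IsLargeEmbedding.adjoinFixedPoint {φ : A → B} (h : IsLargeEmbedding φ) :
    IsLargeEmbedding (A := A.adjoinFixedPoint) (B := B.adjoinFixedPoint) (Option.map φ) where
  injective := Option.map_injective h.injective
  semiconj := semiconj_optionMap h.injective h.semiconj
  exists_generator := by
    obtain ⟨b, hb⟩ := h.exists_generator
    refine ⟨some b, ?_⟩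
    rintro (_ | y) hy
    · exact absurd ⟨none, rfl⟩ hy
    · have hyφ : y ∉ range φ := fun ⟨x, hx⟩ => hy ⟨some x, congrArg some hx⟩
      obtain ⟨k, rfl⟩ := hb y hyφ
      exact exists_iterate_adjoinFixedPoint_eq_some b k

theorem genDist_adjoinFixedPoint_le {A B : MonounaryAlgebra.{u}} :
    genDist AllAlgebras A.adjoinFixedPoint B.adjoinFixedPoint ≤ genDist AllAlgebras A B :=
  genDist_map_le (fun _ _ => trivial) (fun _ _ _ _ e => e.adjoinFixedPoint) fun _ _ _ _ _ h =>
    h.adjoinFixedPoint.genDist_le_one isomorphismClosed_allAlgebras trivial trivial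

end

/-! ### Removing the fixed points -/

open Classical in
/-- The algebra obtained from `A` by removing all fixed points and attaching a loop to every other
element that was sent to one of them. For a tree-algebra it is the forest-algebra. -/
noncomputable def removeFixedPoints (A : MonounaryAlgebra.{u}) : MonounaryAlgebra.{u} where
  carrier := {x : A // x ∉ fixedPoints A.op}
  op x := if hx : A.op x.1 ∈ fixedPoints A.op then x else ⟨A.op x.1, hx⟩

section

variable {A : MonounaryAlgebra.{u}} {B : MonounaryAlgebra.{v}}

theorem removeFixedPoints_op_of_isFixedPt {x : A.removeFixedPoints}
    (h : IsFixedPt A.op (A.op x.1)) : A.removeFixedPoints.op x = x :=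
  dif_pos h

theorem removeFixedPoints_op_of_not_isFixedPt {x : A.removeFixedPoints}
    (h : ¬IsFixedPt A.op (A.op x.1)) : (A.removeFixedPoints.op x).1 = A.op x.1 :=
  congrArg Subtype.val (dif_neg h)

/-- The restriction of an embedding to the elements that are not fixed. -/
def removeFixedPointsMap {φ : A → B} (hinj : Injective φ) (hop : Semiconj φ A.op B.op) :
    A.removeFixedPoints → B.removeFixedPoints :=
  Subtype.map φ fun _ hx => (isFixedPt_apply_iff_of_semiconj hinj hop).not.2 hx

variable {φ : A → B} (hinj : Injective φ) (hop : Semiconj φ A.op B.op)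

theorem removeFixedPointsMap_injective : Injective (removeFixedPointsMap hinj hop) :=
  Subtype.map_injective _ hinj

theorem mem_range_removeFixedPointsMap {y : B.removeFixedPoints} (hy : y.1 ∈ range φ) :
    y ∈ range (removeFixedPointsMap hinj hop) := by
  obtain ⟨x, hx⟩ := hy
  have hxfix : ¬IsFixedPt A.op x := fun h => y.2 (hx ▸ h.map hop)
  exact ⟨⟨x, hxfix⟩, Subtype.ext hx⟩

theorem removeFixedPointsMap_semiconj :
    Semiconj (removeFixedPointsMap hinj hop) A.removeFixedPoints.op B.removeFixedPoints.op := by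
  intro x
  have hfix : IsFixedPt B.op (B.op (φ x.1)) ↔ IsFixedPt A.op (A.op x.1) := by
    rw [← hop.eq, isFixedPt_apply_iff_of_semiconj hinj hop]
  by_cases hx : IsFixedPt A.op (A.op x.1)
  · rw [removeFixedPoints_op_of_isFixedPt hx]
    exact (removeFixedPoints_op_of_isFixedPt (hfix.2 hx)).symm
  · refine Subtype.ext ?_
    calc φ (A.removeFixedPoints.op x).1
      _ = φ (A.op x.1) := congrArg φ (removeFixedPoints_op_of_not_isFixedPt hx)
      _ = B.op (φ x.1) := hop x.1
      _ = (B.removeFixedPoints.op (removeFixedPointsMap hinj hop x)).1 :=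
        (removeFixedPoints_op_of_not_isFixedPt
          (x := removeFixedPointsMap hinj hop x) (hfix.not.2 hx)).symm

theorem isomorphic_removeFixedPoints (hinj : Injective φ) (hop : Semiconj φ A.op B.op)
    (hrange : ∀ y ∉ range φ, IsFixedPt B.op y) :
    Isomorphic A.removeFixedPoints B.removeFixedPoints :=
  isomorphic_of_bijective
    ⟨removeFixedPointsMap_injective hinj hop, fun y =>
      mem_range_removeFixedPointsMap hinj hop (not_imp_comm.1 (hrange y.1) y.2)⟩
    (removeFixedPointsMap_semiconj hinj hop)

theorem Isomorphic.removeFixedPoints (h : Isomorphic A B) :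
    Isomorphic A.removeFixedPoints B.removeFixedPoints := by
  obtain ⟨e, he⟩ := h
  exact isomorphic_removeFixedPoints e.injective he fun y hy => absurd (e.surjective y) hy

theorem exists_iterate_removeFixedPoints_eq (b : A.removeFixedPoints) (k : ℕ)
    (hk : ¬IsFixedPt A.op (A.op^[k] b.1)) :
    ∃ j : ℕ, (A.removeFixedPoints.op^[j] b).1 = A.op^[k] b.1 := by
  induction k with
  | zero => exact ⟨0, rfl⟩
  | succ k ih =>
    rw [iterate_succ_apply'] at hk ⊢
    obtain ⟨j, hj⟩ := ih fun h => hk (congrArg A.op h)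
    rw [← hj] at hk ⊢
    exact ⟨j + 1, by rw [iterate_succ_apply', removeFixedPoints_op_of_not_isFixedPt hk]⟩

theorem IsLargeEmbedding.removeFixedPoints (h : IsLargeEmbedding φ) :
    Isomorphic A.removeFixedPoints B.removeFixedPoints ∨
      IsLargeEmbedding (removeFixedPointsMap h.injective h.semiconj) := by
  obtain ⟨b, hb⟩ := h.exists_generator
  by_cases hfix : IsFixedPt B.op b
  · refine Or.inl (isomorphic_removeFixedPoints h.injective h.semiconj fun y hy => ?_)
    obtain ⟨k, rfl⟩ := hb y hy
    rwa [(hfix.iterate k).eq]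
  · refine Or.inr ⟨removeFixedPointsMap_injective _ _, removeFixedPointsMap_semiconj _ _,
      ⟨b, hfix⟩, fun y hy => ?_⟩
    obtain ⟨k, hk⟩ := hb y.1 (mt (mem_range_removeFixedPointsMap _ _) hy)
    obtain ⟨j, hj⟩ := exists_iterate_removeFixedPoints_eq ⟨b, hfix⟩ k (hk ▸ y.2)
    exact ⟨j, Subtype.ext (hj.trans hk)⟩

theorem genDist_removeFixedPoints_le {A B : MonounaryAlgebra.{u}} :
    genDist AllAlgebras A.removeFixedPoints B.removeFixedPoints ≤ genDist AllAlgebras A B := by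
  refine genDist_map_le (fun _ _ => trivial) (fun _ _ _ _ e => e.removeFixedPoints)
    fun _ _ _ _ _ h => ?_
  rcases h.removeFixedPoints with e | h
  · exact (e.genDist_eq_zero trivial trivial).trans_le zero_le_one
  · exact h.genDist_le_one isomorphismClosed_allAlgebras trivial trivial

end

/-! ### Algebras with exactly one fixed point -/

section

variable {T : MonounaryAlgebra.{u}}

theorem isomorphic_adjoinFixedPoint_removeFixedPoints (h : ∃! c : T, IsFixedPt T.op c) :
    Isomorphic T.removeFixedPoints.adjoinFixedPoint T := by
  obtain ⟨c, hc, hunique⟩ := h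
  let φ : T.removeFixedPoints.adjoinFixedPoint → T := fun x => Option.elim x c Subtype.val
  have hinj : Injective φ := by
    rintro (_ | x) (_ | y) hxy
    · rfl
    · exact absurd ((show c = y.1 from hxy) ▸ hc) y.2
    · exact absurd ((show x.1 = c from hxy) ▸ hc) x.2
    · exact congrArg some (Subtype.ext hxy)
  have hsurj : Surjective φ := fun y => by
    by_cases hy : IsFixedPt T.op y
    · exact ⟨none, (hunique y hy).symm⟩
    · exact ⟨some ⟨y, hy⟩, rfl⟩
  refine isomorphic_of_bijective ⟨hinj, hsurj⟩ ?_
  rintro (_ | x)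
  · exact hc.symm
  by_cases hx : IsFixedPt T.op (T.op x.1)
  · exact (congrArg φ (adjoinFixedPoint_op_some_of_isFixedPt
      (removeFixedPoints_op_of_isFixedPt hx))).trans (hunique _ hx).symm
  · have hop := removeFixedPoints_op_of_not_isFixedPt hx
    have hx' : ¬IsFixedPt T.removeFixedPoints.op x := fun h =>
      x.2 (hop.symm.trans (congrArg Subtype.val h))
    exact (congrArg φ (adjoinFixedPoint_op_some_of_not_isFixedPt hx')).trans hop

theorem nonempty_removeFixedPoints [Nontrivial T] (h : ∃! c : T, IsFixedPt T.op c) :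
    Nonempty T.removeFixedPoints := by
  obtain ⟨c, -, hunique⟩ := h
  obtain ⟨x, hx⟩ := exists_ne c
  exact ⟨⟨x, mt (hunique x) hx⟩⟩

theorem genDist_removeFixedPoints {T₁ T₂ : MonounaryAlgebra.{u}}
    (h₁ : ∃! c : T₁, IsFixedPt T₁.op c) (h₂ : ∃! c : T₂, IsFixedPt T₂.op c) :
    genDist AllAlgebras T₁.removeFixedPoints T₂.removeFixedPoints =
      genDist AllAlgebras T₁ T₂ := by
  have e₁ := isomorphic_adjoinFixedPoint_removeFixedPoints h₁
  have e₂ := isomorphic_adjoinFixedPoint_removeFixedPoints h₂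
  refine le_antisymm genDist_removeFixedPoints_le ?_
  calc genDist AllAlgebras T₁ T₂
    _ ≤ genDist AllAlgebras T₁.removeFixedPoints.adjoinFixedPoint T₂ :=
      e₁.symm.genDist_le_left trivial trivial
    _ ≤ genDist AllAlgebras T₁.removeFixedPoints.adjoinFixedPoint
          T₂.removeFixedPoints.adjoinFixedPoint := e₂.genDist_le_right trivial trivial
    _ ≤ genDist AllAlgebras T₁.removeFixedPoints T₂.removeFixedPoints :=
      genDist_adjoinFixedPoint_le

theorem IsTree.exists_core_eq_singleton (h : T.IsTree) : ∃ c : T, h.core.carrier = {c} := by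
  obtain ⟨e, -⟩ := h.2.choose_spec.2
  have : Unique (cycleAlgebra 1) := inferInstanceAs (Unique (ZMod 1))
  have : Unique h.core.carrier := e.unique
  exact exists_eq_singleton_iff_nonempty_subsingleton.2
    ⟨⟨_, (default : h.core.carrier).2⟩, subsingleton_coe _ |>.1 inferInstance⟩

theorem Connected.subsingleton_fixedPoints (h : T.Connected) :
    (fixedPoints T.op).Subsingleton := by
  intro x hx y hy
  obtain ⟨k, m, hkm⟩ := h x y
  rwa [iterate_fixed hx, iterate_fixed hy] at hkm

theorem IsTree.exists_fixedPoints_eq_core (h : T.IsTree) :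
    ∃ c : T, fixedPoints T.op = {c} ∧ h.core.carrier = {c} := by
  obtain ⟨c, hcore⟩ := h.exists_core_eq_singleton
  have hc : IsFixedPt T.op c := by
    have hop := h.core.op_mem
    rw [hcore] at hop
    exact hop c rfl
  exact ⟨c, h.1.subsingleton_fixedPoints.eq_singleton_of_mem hc, hcore⟩

theorem IsTree.existsUnique_isFixedPt (h : T.IsTree) : ∃! c : T, IsFixedPt T.op c := by
  obtain ⟨c, hc, -⟩ := h.exists_fixedPoints_eq_core
  exact ⟨c, eq_singleton_iff_unique_mem.1 hc⟩

theorem IsTree.forest_eq_removeFixedPoints (h : T.IsTree) : h.forest = T.removeFixedPoints := by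
  obtain ⟨c, hfix, hcore⟩ := h.exists_fixedPoints_eq_core
  have hcore_fix : h.core.carrier = fixedPoints T.op := hcore.trans hfix.symm
  unfold IsTree.forest removeFixedPoints
  generalize h.core.carrier = s at hcore_fix
  subst hcore_fix
  -- Only the decidability instances of the two definitions differ.
  congr!

end

/-! ### Avoiding the empty algebra -/

/-- An algebra generated by a single element; these are the algebras joined to the empty algebra by
a blue edge. -/
def Monogenic (A : MonounaryAlgebra.{u}) : Prop :=
  ∃ a : A, ∀ y : A, ∃ k : ℕ, A.op^[k] a = y

/-- The disjoint union of two algebras. -/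
def sum (A : MonounaryAlgebra.{u}) (B : MonounaryAlgebra.{v}) : MonounaryAlgebra.{max u v} where
  carrier := A ⊕ B
  op := Sum.map A.op B.op

theorem Monogenic.nonempty {A : MonounaryAlgebra.{u}} (h : Monogenic A) : Nonempty A :=
  ⟨h.choose⟩

section

variable {A : MonounaryAlgebra.{u}} {B : MonounaryAlgebra.{v}}

theorem Monogenic.isLargeEmbedding_inl (h : Monogenic B) :
    IsLargeEmbedding (A := A) (B := A.sum B) Sum.inl where
  injective := Sum.inl_injective
  semiconj _ := rfl
  exists_generator := by
    obtain ⟨b, hb⟩ := h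
    have hinr : Semiconj Sum.inr B.op (A.sum B).op := fun _ => rfl
    refine ⟨Sum.inr b, ?_⟩
    rintro (y | y) hy
    · exact absurd ⟨y, rfl⟩ hy
    · obtain ⟨k, rfl⟩ := hb y
      exact ⟨k, (hinr.iterate_right k b).symm⟩

theorem Monogenic.isLargeEmbedding_inr (h : Monogenic A) :
    IsLargeEmbedding (A := B) (B := A.sum B) Sum.inr where
  injective := Sum.inr_injective
  semiconj _ := rfl
  exists_generator := by
    obtain ⟨a, ha⟩ := h
    have hinl : Semiconj Sum.inl A.op (A.sum B).op := fun _ => rfl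
    refine ⟨Sum.inl a, ?_⟩
    rintro (y | y) hy
    · obtain ⟨k, rfl⟩ := ha y
      exact ⟨k, (hinl.iterate_right k a).symm⟩
    · exact absurd ⟨y, rfl⟩ hy

end

section

variable {A B : MonounaryAlgebra.{u}}

theorem Monogenic.genDist_nonemptyAlgebras_le_two (hA : Monogenic A) (hB : Monogenic B) :
    genDist NonemptyAlgebras A B ≤ 2 := by
  have hsum : NonemptyAlgebras (A.sum B) := hA.nonempty.map Sum.inl
  have hle_left : genDist NonemptyAlgebras A (A.sum B) ≤ 1 :=
    hB.isLargeEmbedding_inl.genDist_le_one isomorphismClosed_nonemptyAlgebras hA.nonempty hsum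
  have hle_right : genDist NonemptyAlgebras B (A.sum B) ≤ 1 :=
    hA.isLargeEmbedding_inr.genDist_le_one isomorphismClosed_nonemptyAlgebras hB.nonempty hsum
  calc genDist NonemptyAlgebras A B
    _ ≤ genDist NonemptyAlgebras A (A.sum B) + genDist NonemptyAlgebras (A.sum B) B :=
      genDist_triangle
    _ ≤ 1 + 1 := add_le_add hle_left (genDist_comm.trans_le hle_right)
    _ = 2 := one_add_one_eq_two

theorem BlueEdge.monogenic [IsEmpty A] (h : BlueEdge A B) : Monogenic B := by
  rcases h.exists_isLargeEmbedding with ⟨φ, hφ⟩ | ⟨φ, hφ⟩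
  · obtain ⟨b, hb⟩ := hφ.exists_generator
    exact ⟨b, fun y => hb y fun ⟨x, _⟩ => isEmptyElim x⟩
  · obtain ⟨a, -⟩ := hφ.exists_generator
    exact isEmptyElim a

-- The second clause strengthens the induction: a path that has reached the empty algebra is
-- continued to every possible exit.
theorem HasPath.genDist_nonemptyAlgebras_le {l : ℕ} (p : HasPath AllAlgebras A B l)
    (hA : Nonempty A) :
    (Nonempty B → genDist NonemptyAlgebras A B ≤ l) ∧
      (IsEmpty B → ∀ M, Monogenic M → genDist NonemptyAlgebras A M ≤ l + 1) := by
  induction p with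
  | nil _ =>
    exact ⟨fun hA => (HasPath.nil A hA).genDist_le, fun hA' => absurd hA (not_nonempty_iff.2 hA')⟩
  | red _ _ e ih =>
    obtain ⟨ih_nonempty, ih_empty⟩ := ih
    refine ⟨fun hC => ?_, fun hC => ih_empty e.choose.isEmpty⟩
    have hB := isomorphismClosed_nonemptyAlgebras e.symm hC
    exact (e.genDist_le_right hB hC).trans (ih_nonempty hB)
  | @blue B C l _ _ e ih =>
    rcases isEmpty_or_nonempty B with hB | hB
    · have hC : Monogenic C := e.monogenic
      refine ⟨fun _ => ?_, fun hC' => absurd hC.nonempty (not_nonempty_iff.2 hC')⟩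
      exact_mod_cast ih.2 hB C hC
    · have hAB := ih.1 hB
      constructor
      · intro hC
        exact genDist_triangle.trans (add_le_add hAB (e.genDist_le_one hB hC))
      · intro hC M hM
        have hB_gen : Monogenic B := e.symm.monogenic
        calc genDist NonemptyAlgebras _ M
          _ ≤ genDist NonemptyAlgebras _ B + genDist NonemptyAlgebras B M := genDist_triangle
          _ ≤ l + 2 := add_le_add hAB (hB_gen.genDist_nonemptyAlgebras_le_two hM)
          _ = (l + 1 : ℕ) + 1 := by push_cast; rw [add_assoc, one_add_one_eq_two]

theorem genDist_nonemptyAlgebras (hA : Nonempty A) (hB : Nonempty B) :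
    genDist NonemptyAlgebras A B = genDist AllAlgebras A B :=
  le_antisymm (le_genDist fun _ p => (p.genDist_nonemptyAlgebras_le hA).1 hB)
    (genDist_mono fun _ _ => trivial)

end

end MonounaryAlgebra

open MonounaryAlgebra Function in
theorem mainTheorem3_general (T₁ T₂ : MonounaryAlgebra.{u}) (h₁ : ∃! c : T₁, IsFixedPt T₁.op c)
    (h₂ : ∃! c : T₂, IsFixedPt T₂.op c) :
    genDist AllAlgebras T₁ T₂ =
        genDist AllAlgebras T₁.removeFixedPoints T₂.removeFixedPoints ∧
      (Nontrivial T₁ → Nontrivial T₂ →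
        genDist NonemptyAlgebras T₁ T₂ =
          genDist NonemptyAlgebras T₁.removeFixedPoints T₂.removeFixedPoints) := by
  refine ⟨(genDist_removeFixedPoints h₁ h₂).symm, fun _ _ => ?_⟩
  rw [genDist_nonemptyAlgebras inferInstance inferInstance,
    genDist_nonemptyAlgebras (nonempty_removeFixedPoints h₁) (nonempty_removeFixedPoints h₂),
    genDist_removeFixedPoints h₁ h₂]

theorem mainTheorem3 (T₁ T₂ : MonounaryAlgebra.{u}) (h₁ : T₁.IsTree) (h₂ : T₂.IsTree) :
    MonounaryAlgebra.genDist MonounaryAlgebra.AllAlgebras T₁ T₂ =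
        MonounaryAlgebra.genDist MonounaryAlgebra.AllAlgebras h₁.forest h₂.forest ∧
      (Nontrivial T₁ → Nontrivial T₂ →
        MonounaryAlgebra.genDist MonounaryAlgebra.NonemptyAlgebras T₁ T₂ =
          MonounaryAlgebra.genDist MonounaryAlgebra.NonemptyAlgebras h₁.forest h₂.forest) := by
  rw [h₁.forest_eq_removeFixedPoints, h₂.forest_eq_removeFixedPoints]
  exact mainTheorem3_general T₁ T₂ h₁.existsUnique_isFixedPt h₂.existsUnique_isFixedPt
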